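/- For a probability measure $\mu$ on $\mathbb R$ with distribution function $F$, let $F^{-1}(p)=\inf\{x : F(x)\ge p\}\in[-\infty,\infty]$. A $K$-armed bandit is a tuple $\nu=(\nu_1,\dots,\nu_K)$ of probability measures on $\mathbb R$ with distribution functions $F_1,\dots,F_K$; an arm $i^*$ is its unique best arm at level $q$ if $F_i^{-1}(q)<F_{i^*}^{-1}(q)$ for all $i\ne i^*$, and then the gap of an arm $i\neq i^*$ is $$\Delta_i=\sup\{\eta\ge 0:\ F_i^{-1}(q+\eta)\le F_{i^*}^{-1}(q-\eta)\}.$$ A (possibly randomized) policy decides in each round, on the basis of the arms pulled and the rewards observed so far, either to pull an arm $i$, whereupon it receives an independent reward of law $\nu_i$, or to stop and declare an arm $\hat k$; $\tau\in\{0,1,\dots\}\cup\{\infty\}$ is the number of pulls before it stops. The policy is $\delta$-PAC (at level $q$) if, on every $K$-armed bandit with a unique best arm $i^*$ and gaps $\Delta_i>0$ for all $i\ne i^*$, it stops and declares $\hat k=i^*$ with probability at least $1-\delta$. **Theorem.** Let $K\ge 1$, $q\in(1/3,1)$ and $\delta\in(0,1)$. There exists a $K$-armed bandit $\nu$ with a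 unique best arm $i^*$ at level $q$ and gaps $\Delta_i\in(0,1/4)$ for all $i\neq i^*$, each of whose arms is a mixture $w_i\,\delta_0+(1-w_i)\,\mathrm{Unif}[0,1]$, $w_i\in(0,1)$, of a point mass at $0$ and the uniform distribution on $[0,1]$, such that every $\delta$-PAC policy $\pi$ satisfies, when run on $\nu$, $$\mathbb E_{\pi}[\tau]\ \ge\ \sum_{j\ne i^*}\frac{3(1-q)^2}{100\,\Delta_j^2}\,\log\frac{1}{4\delta}.$$ -/

import Mathlib

open MeasureTheory ProbabilityTheory
open scoped ENNReal

noncomputable section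

namespace QuantileBandit

/-! ### Quantiles, best arm, suboptimality gap -/

/-- The (left) `p`-quantile `inf {x : F(x) ≥ p}` of a distribution on the real line with
distribution function `F`. It is extended-real-valued, so that the infimum is `+∞` when no `x`
qualifies (for instance for `p > 1`) and `-∞` when every `x` does (for `p ≤ 0`). -/
def quantile (μ : Measure ℝ) (p : ℝ) : EReal :=
  sInf ((fun x : ℝ => (x : EReal)) '' {x : ℝ | p ≤ cdf μ x})

/-- The suboptimality gap at level `q` between a distribution `μl` (suboptimal arm) and a
distribution `μh` (best arm): the supremum of the `η ≥ 0` such that the `(q+η)`-quantile of `μl`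
is at most the `(q-η)`-quantile of `μh`. For `q > 0` and probability measures the set is
contained in `[0, q]`, so this is a supremum of a bounded set. -/
def gap (q : ℝ) (μl μh : Measure ℝ) : ℝ :=
  sSup {η : ℝ | 0 ≤ η ∧ quantile μl (q + η) ≤ quantile μh (q - η)}

/-- Arm `i` is the unique best arm: its `q`-quantile is strictly larger than all the others. -/
def IsBestArm {K : ℕ} (q : ℝ) (ν : Fin K → ProbabilityMeasure ℝ) (i : Fin K) : Prop :=
  ∀ j, j ≠ i → quantile (ν j) q < quantile (ν i) q

/-- The mixture of a point mass at `0` (weight `w`) and the uniform distribution on `[0,1]`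
(weight `1 - w`). -/
def zeroUniformMixture (w : ℝ) : Measure ℝ :=
  ENNReal.ofReal w • Measure.dirac 0 +
    ENNReal.ofReal (1 - w) • (volume : Measure ℝ).restrict (Set.Icc 0 1)

/-! ### Policies and their interaction with a bandit -/

/-- What a policy decides in one round: `inl i` means "pull arm `i`", and `inr k` means
"stop sampling and declare arm `k`". -/
abbrev Decision (K : ℕ) : Type := Fin K ⊕ Fin K

/-- What is recorded in one round: `inl (i, x)` means "arm `i` was pulled and the reward was `x`",
and `inr k` means "the policy has stopped and has declared arm `k`". -/
abbrev Outcome (K : ℕ) : Type := (Fin K × ℝ) ⊕ Fin K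

/-- A (possibly randomized) policy for `K` arms: the distribution of the decision in round `0`, and
the conditional distribution of the decision in round `n + 1` given the outcomes of the
rounds `0, …, n`. (What it prescribes after it has stopped is never used.) -/
structure Policy (K : ℕ) where
  first : Measure (Decision K)
  next : (n : ℕ) → Kernel (Finset.Iic n → Outcome K) (Decision K)
  first_prob : IsProbabilityMeasure first
  next_markov : ∀ n, IsMarkovKernel (next n)

attribute [instance] Policy.first_prob Policy.next_markov

variable {K : ℕ}

/-- The bandit's answer to a decision: a reward drawn from the law of the pulled arm. -/
def answer (ν : Fin K → ProbabilityMeasure ℝ) : Kernel (Decision K) (Outcome K) where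
  toFun := Sum.elim (fun i => (ν i : Measure ℝ).map fun x => .inl (i, x))
    (fun k => Measure.dirac (.inr k))
  measurable' := Measurable.sumElim (measurable_of_countable _) (measurable_of_countable _)

instance (ν : Fin K → ProbabilityMeasure ℝ) : IsMarkovKernel (answer ν) := by
  refine ⟨fun d => ?_⟩
  rcases d with i | k
  · exact Measure.isProbabilityMeasure_map
      (measurable_inl.comp measurable_prodMk_left).aemeasurable
  · exact inferInstanceAs (IsProbabilityMeasure (Measure.dirac (Sum.inr k : Outcome K)))

/-- The histories of the rounds `0, …, n` in which the policy has stopped by round `n`. -/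
def stoppedBy (K n : ℕ) : Set (Finset.Iic n → Outcome K) :=
  {h | (h ⟨n, Finset.mem_Iic.2 le_rfl⟩).isRight}

lemma measurableSet_isRight (K : ℕ) : MeasurableSet {o : Outcome K | o.isRight} := by
  have : {o : Outcome K | o.isRight} = Set.range Sum.inr := by
    ext o; cases o <;> simp
  rw [this]
  exact measurableSet_range_inr

lemma measurableSet_stoppedBy (K n : ℕ) : MeasurableSet (stoppedBy K n) :=
  measurable_pi_apply (X := fun _ : Finset.Iic n => Outcome K) ⟨n, Finset.mem_Iic.2 le_rfl⟩
    (measurableSet_isRight K)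

open Classical in
/-- The conditional law of the outcome of round `n + 1` given the outcomes of the rounds
`0, …, n`: once the policy has stopped, its declaration is repeated forever; otherwise the policy
takes a decision and the bandit answers. -/
def Policy.round (π : Policy K) (ν : Fin K → ProbabilityMeasure ℝ) (n : ℕ) :
    Kernel (Finset.Iic n → Outcome K) (Outcome K) :=
  Kernel.piecewise (measurableSet_stoppedBy K n)
    (Kernel.deterministic (fun h => h ⟨n, Finset.mem_Iic.2 le_rfl⟩) (measurable_pi_apply _))
    (answer ν ∘ₖ π.next n)

instance (π : Policy K) (ν : Fin K → ProbabilityMeasure ℝ) (n : ℕ) :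
    IsMarkovKernel (π.round ν n) := by
  unfold Policy.round
  infer_instance

/-- The law, on infinite sequences of outcomes, of the interaction of a policy with a bandit. -/
def Policy.law (π : Policy K) (ν : Fin K → ProbabilityMeasure ℝ) : Measure (ℕ → Outcome K) :=
  Kernel.trajMeasure (X := fun _ => Outcome K) (answer ν ∘ₘ π.first) (π.round ν)

/-- The stopping time: the number of pulls made before the policy stops, `∞` if it never does. -/
def stoppingTime (ω : ℕ → Outcome K) : ℝ≥0∞ :=
  ⨅ (n : ℕ) (_ : (ω n).isRight), (n : ℝ≥0∞)

/-- The event that the policy stops, and declares arm `k`. -/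
def declares (k : Fin K) : Set (ℕ → Outcome K) :=
  {ω | ∃ n, ω n = .inr k ∧ ∀ m < n, (ω m).isLeft}

/-- `δ`-PAC policies for the level `q`: on every bandit with a unique best arm and positive
gaps, the policy stops and declares the best arm with probability at least `1 - δ`. -/
def Policy.IsPAC (q δ : ℝ) (π : Policy K) : Prop :=
  ∀ (ν : Fin K → ProbabilityMeasure ℝ) (i : Fin K),
    IsBestArm q ν i → (∀ j, j ≠ i → 0 < gap q (ν j) (ν i)) →
      ENNReal.ofReal (1 - δ) ≤ π.law ν (declares i)

end QuantileBandit

end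

/-! The lower bound is a change of measure, carried out with inequalities between measures. If every
arm `i` of `ν` satisfies `ν i ≤ c i • ν' i`, then an event of the rounds `0, …, n` on which the
product of the `c i` over the pulls made is at most `C` has probability under `ν` at most `C` times
its probability under `ν'`.

For mixtures `w δ₀ + (1 - w) Unif[0,1]`, the arm of smallest weight is the best. Lowering the weight
`w j` of a suboptimal arm `j` to a `v` below all the others makes `j` the best arm, at the cost of
a ratio `c = w j / v` per pull of `j`. A `δ`-PAC policy declares the former best arm `k` with
probability at least `1 - δ` before this modification, and at most `δ` after it. Hence
`1 - δ ≤ P(N_j ≥ m + 1) + c ^ m δ` for the number `N_j` of pulls of `j`, and Markov's inequality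
with `c ^ m ≈ 1 / (4 δ)` bounds `E[N_j]` below by a multiple of `log (1 / (4 δ)) / log c`.
Finally `∑ j, N_j ≤ τ`. -/

open scoped Finset

namespace QuantileBandit

section Quantile

variable {μ : Measure ℝ} {p q w v η : ℝ}

lemma quantile_of_nonpos (μ : Measure ℝ) (hp : p ≤ 0) : quantile μ p = ⊥ := by
  refine sInf_eq_bot.2 fun b hb => ?_
  obtain ⟨x, -, hx⟩ := EReal.lt_iff_exists_real_btwn.1 hb
  exact ⟨x, ⟨x, hp.trans (cdf_nonneg μ x), rfl⟩, hx⟩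

lemma quantile_of_one_lt (μ : Measure ℝ) (hp : 1 < p) : quantile μ p = ⊤ := by
  have h_empty : {x : ℝ | p ≤ cdf μ x} = ∅ :=
    Set.eq_empty_of_forall_notMem fun x hx => ((cdf_le_one μ x).trans_lt hp).not_ge hx
  rw [quantile, h_empty, Set.image_empty, sInf_empty]

lemma bot_lt_quantile (μ : Measure ℝ) (hp : 0 < p) : ⊥ < quantile μ p := by
  obtain ⟨x, hx⟩ := ((tendsto_cdf_atBot μ).eventually_lt_const hp).exists
  refine (EReal.bot_lt_coe x).trans_le (le_sInf ?_)
  rintro _ ⟨y, hy, rfl⟩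
  exact EReal.coe_le_coe_iff.2 ((monotone_cdf μ).reflect_lt (hx.trans_le hy)).le

lemma quantile_eq_coe {a : ℝ} (h : ∀ x, p ≤ cdf μ x ↔ a ≤ x) : quantile μ p = a := by
  refine IsLeast.csInf_eq ⟨⟨a, (h a).2 le_rfl, rfl⟩, ?_⟩
  rintro _ ⟨x, hx, rfl⟩
  exact EReal.coe_le_coe_iff.2 ((h x).1 hx)

lemma isProbabilityMeasure_zeroUniformMixture (h0 : 0 ≤ w) (h1 : w ≤ 1) :
    IsProbabilityMeasure (zeroUniformMixture w) := by
  refine ⟨?_⟩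
  simp only [zeroUniformMixture, Measure.add_apply, Measure.smul_apply, measure_univ, smul_eq_mul,
    mul_one, Measure.restrict_apply_univ, Real.volume_Icc, sub_zero, ENNReal.ofReal_one]
  rw [← ENNReal.ofReal_add h0 (sub_nonneg.2 h1), add_sub_cancel, ENNReal.ofReal_one]

lemma cdf_zeroUniformMixture_of_neg (h0 : 0 ≤ w) (h1 : w ≤ 1) {x : ℝ} (hx : x < 0) :
    cdf (zeroUniformMixture w) x = 0 := by
  have := isProbabilityMeasure_zeroUniformMixture h0 h1
  have h_inter : Set.Iic x ∩ Set.Icc 0 1 = ∅ :=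
    Set.eq_empty_of_forall_notMem fun y hy => (hy.1.trans_lt hx).not_ge hy.2.1
  rw [cdf_eq_real, measureReal_def]
  simp [zeroUniformMixture, Measure.restrict_apply measurableSet_Iic, h_inter, hx]

lemma cdf_zeroUniformMixture_of_nonneg (h0 : 0 ≤ w) (h1 : w ≤ 1) {x : ℝ} (hx : 0 ≤ x) :
    cdf (zeroUniformMixture w) x = w + (1 - w) * min x 1 := by
  have := isProbabilityMeasure_zeroUniformMixture h0 h1
  have h_inter : Set.Iic x ∩ Set.Icc 0 1 = Set.Icc 0 (min x 1) := by
    rw [Set.inter_comm, ← Set.Ici_inter_Iic, Set.inter_assoc, Set.Iic_inter_Iic, min_comm,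
      Set.Ici_inter_Iic]
  have h_min : 0 ≤ (1 - w) * min x 1 := mul_nonneg (sub_nonneg.2 h1) (le_min hx zero_le_one)
  have h_measure : zeroUniformMixture w (Set.Iic x) = ENNReal.ofReal (w + (1 - w) * min x 1) := by
    rw [ENNReal.ofReal_add h0 h_min, ENNReal.ofReal_mul (sub_nonneg.2 h1)]
    simp [zeroUniformMixture, Measure.restrict_apply measurableSet_Iic, h_inter, hx]
  rw [cdf_eq_real, measureReal_def, h_measure, ENNReal.toReal_ofReal (add_nonneg h0 h_min)]

lemma quantile_zeroUniformMixture (h0 : 0 ≤ w) (h1 : w < 1) (hp : 0 < p) (hp1 : p ≤ 1) :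
    quantile (zeroUniformMixture w) p = (max 0 ((p - w) / (1 - w)) : ℝ) := by
  have hw : 0 < 1 - w := sub_pos.2 h1
  refine quantile_eq_coe fun x => ?_
  rw [max_le_iff, div_le_iff₀ hw]
  rcases lt_or_ge x 0 with hx | hx
  · rw [cdf_zeroUniformMixture_of_neg h0 h1.le hx]
    exact iff_of_false hp.not_ge fun h => hx.not_ge h.1
  rw [cdf_zeroUniformMixture_of_nonneg h0 h1.le hx, and_iff_right hx, sub_le_iff_le_add',
    mul_comm x]
  rcases le_total x 1 with h | h
  · rw [min_eq_left h]
  · rw [min_eq_right h]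
    exact iff_of_true (by linarith) (by nlinarith)

lemma quantile_zeroUniformMixture_lt (hq1 : q < 1) (hv0 : 0 ≤ v) (hvw : v < w) (hvq : v < q)
    (hw1 : w < 1) :
    quantile (zeroUniformMixture w) q < quantile (zeroUniformMixture v) q := by
  have hq : 0 < q := hv0.trans_lt hvq
  rw [quantile_zeroUniformMixture (hv0.trans hvw.le) hw1 hq hq1.le,
    quantile_zeroUniformMixture hv0 (hvw.trans hw1) hq hq1.le, EReal.coe_lt_coe_iff]
  have h_pos : 0 < (q - v) / (1 - v) := div_pos (by linarith) (by linarith)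
  refine lt_max_of_lt_right (max_lt h_pos ?_)
  rw [div_lt_div_iff₀ (by linarith) (by linarith)]
  nlinarith

lemma quantile_zeroUniformMixture_le_iff (hq1 : q < 1) (hw0 : 0 ≤ w) (hw1 : w < 1)
    (hv0 : 0 ≤ v) (hv1 : v < 1) (hη : 0 ≤ η) (hηq : η < q) :
    quantile (zeroUniformMixture w) (q + η) ≤ quantile (zeroUniformMixture v) (q - η) ↔
      η ≤ max (w - q) ((1 - q) * (w - v) / (2 - w - v)) := by
  have hw : 0 < 1 - w := sub_pos.2 hw1
  have hv : 0 < 1 - v := sub_pos.2 hv1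
  have hwv : 0 < 2 - w - v := by linarith
  rw [quantile_zeroUniformMixture hv0 hv1 (by linarith : 0 < q - η) (by linarith)]
  rcases lt_or_ge (1 - q) η with h | h
  · rw [quantile_of_one_lt _ (by linarith : 1 < q + η), top_le_iff]
    refine iff_of_false (EReal.coe_ne_top _) (not_le.2 ((max_le (by linarith) ?_).trans_lt h))
    rw [div_le_iff₀ hwv]
    nlinarith
  have h_div : (q + η - w) / (1 - w) ≤ (q - η - v) / (1 - v) ↔
      η ≤ (1 - q) * (w - v) / (2 - w - v) := by
    rw [div_le_div_iff₀ hw hv, le_div_iff₀ hwv]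
    constructor <;> intro h <;> linarith
  have h_nonpos : (q + η - w) / (1 - w) ≤ 0 ↔ η ≤ w - q := by
    rw [div_le_iff₀ hw, zero_mul]
    constructor <;> intro h <;> linarith
  rw [quantile_zeroUniformMixture hw0 hw1 (by linarith : 0 < q + η) (by linarith),
    EReal.coe_le_coe_iff, max_le_iff, and_iff_right (le_max_left _ _), le_max_iff, h_nonpos, h_div,
    le_max_iff]

lemma gap_zeroUniformMixture (hq : 0 < q) (hq1 : q < 1) (hv0 : 0 ≤ v) (hvw : v ≤ w)
    (hw1 : w < 1) :
    gap q (zeroUniformMixture w) (zeroUniformMixture v) =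
      min q (max (w - q) ((1 - q) * (w - v) / (2 - w - v))) := by
  set M := max (w - q) ((1 - q) * (w - v) / (2 - w - v))
  have hM0 : 0 ≤ M := le_max_of_le_right (div_nonneg (mul_nonneg (by linarith) (by linarith))
    (by linarith))
  have h_set : {η : ℝ | 0 ≤ η ∧ quantile (zeroUniformMixture w) (q + η) ≤
      quantile (zeroUniformMixture v) (q - η)} = {η | 0 ≤ η ∧ η < q ∧ η ≤ M} := by
    ext η
    refine and_congr_right fun hη => ?_
    rcases lt_or_ge η q with h | h
    · rw [quantile_zeroUniformMixture_le_iff hq1 (hv0.trans hvw) hw1 hv0 (hvw.trans_lt hw1) hη h,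
        and_iff_right h]
    · rw [quantile_of_nonpos _ (sub_nonpos.2 h), le_bot_iff]
      exact iff_of_false (bot_lt_quantile _ (by linarith)).ne' fun h' => h'.1.not_ge h
  rw [gap, h_set]
  rcases lt_or_ge M q with h | h
  · rw [min_eq_right h.le]
    exact IsGreatest.csSup_eq ⟨⟨hM0, h, le_rfl⟩, fun η hη => hη.2.2⟩
  · have h_Ico : {η : ℝ | 0 ≤ η ∧ η < q ∧ η ≤ M} = Set.Ico 0 q :=
      Set.ext fun η => ⟨fun hη => ⟨hη.1, hη.2.1⟩, fun hη => ⟨hη.1, hη.2, hη.2.le.trans h⟩⟩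
    rw [h_Ico, csSup_Ico hq, min_eq_left h]

lemma gap_zeroUniformMixture_pos (hq : 0 < q) (hq1 : q < 1) (hv0 : 0 ≤ v) (hvw : v < w)
    (hw1 : w < 1) : 0 < gap q (zeroUniformMixture w) (zeroUniformMixture v) := by
  rw [gap_zeroUniformMixture hq hq1 hv0 hvw.le hw1]
  exact lt_min hq (lt_max_of_lt_right (div_pos (mul_pos (by linarith) (by linarith))
    (by linarith)))

lemma zeroUniformMixture_le_smul (hv : 0 < v) (hvw : v ≤ w) :
    zeroUniformMixture w ≤ ENNReal.ofReal (w / v) • zeroUniformMixture v := by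
  have h_ratio : 0 ≤ w / v := div_nonneg (hv.le.trans hvw) hv.le
  have h_zero : w ≤ w / v * v := (div_mul_cancel₀ w hv.ne').ge
  have h_uniform : 1 - w ≤ w / v * (1 - v) := by
    rw [mul_sub, mul_one, div_mul_cancel₀ w hv.ne']
    gcongr
    exact (one_le_div hv).2 hvw
  rw [zeroUniformMixture, zeroUniformMixture, smul_add, smul_smul, smul_smul,
    ← ENNReal.ofReal_mul h_ratio, ← ENNReal.ofReal_mul h_ratio]
  refine add_le_add ?_ ?_ <;> refine Measure.le_iff'.2 fun s => ?_ <;>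
    simp only [Measure.smul_apply, smul_eq_mul] <;> gcongr

end Quantile

section ChangeOfMeasure

variable {α β : Type*} [MeasurableSpace α] [MeasurableSpace β]

lemma map_le_withDensity {μ ν : Measure α} {φ : α → β} {g : β → ℝ≥0∞} (hφ : Measurable φ)
    (hg : Measurable g) (h : μ ≤ ν.withDensity (g ∘ φ)) :
    μ.map φ ≤ (ν.map φ).withDensity g := by
  refine Measure.le_iff.2 fun s hs => ?_
  rw [Measure.map_apply hφ hs, withDensity_apply g hs, setLIntegral_map hs hg hφ]
  exact (h _).trans_eq (withDensity_apply _ (hφ hs))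

lemma comp_le_withDensity {κ κ' : Kernel α β} {g : β → ℝ≥0∞} (hg : Measurable g)
    (h : ∀ a, κ a ≤ (κ' a).withDensity g) (μ : Measure α) :
    κ ∘ₘ μ ≤ (κ' ∘ₘ μ).withDensity g := by
  refine Measure.le_iff.2 fun s hs => ?_
  rw [Measure.bind_apply hs κ.aemeasurable, withDensity_apply g hs, ← lintegral_indicator hs,
    Measure.lintegral_bind κ'.aemeasurable (hg.indicator hs).aemeasurable]
  refine lintegral_mono fun a => ?_
  rw [lintegral_indicator hs, ← withDensity_apply g hs]
  exact h a s

lemma compProd_le_withDensity {μ ν : Measure α} [SFinite μ] [SFinite ν] {κ η : Kernel α β}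
    [IsSFiniteKernel κ] [IsSFiniteKernel η] {f : α → ℝ≥0∞} {g : β → ℝ≥0∞} (hf : Measurable f)
    (hg : Measurable g) (hμ : μ ≤ ν.withDensity f) (hκ : ∀ a, κ a ≤ (η a).withDensity g) :
    μ ⊗ₘ κ ≤ (ν ⊗ₘ η).withDensity fun p => f p.1 * g p.2 := by
  refine Measure.le_iff.2 fun s hs => ?_
  have hG : Measurable (s.indicator fun p : α × β => g p.2) := (hg.comp measurable_snd).indicator hs
  have h_slice (a : α) : (η a).withDensity g (Prod.mk a ⁻¹' s) =
      ∫⁻ b, s.indicator (fun p => g p.2) (a, b) ∂η a := by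
    rw [withDensity_apply g (measurable_prodMk_left hs),
      ← lintegral_indicator (measurable_prodMk_left hs)]
    rfl
  calc (μ ⊗ₘ κ) s
      = ∫⁻ a, κ a (Prod.mk a ⁻¹' s) ∂μ := Measure.compProd_apply hs
    _ ≤ ∫⁻ a, ∫⁻ b, s.indicator (fun p => g p.2) (a, b) ∂η a ∂ν.withDensity f :=
        lintegral_mono' hμ fun a => (hκ a _).trans_eq (h_slice a)
    _ = ∫⁻ a, f a * ∫⁻ b, s.indicator (fun p => g p.2) (a, b) ∂η a ∂ν :=
        lintegral_withDensity_eq_lintegral_mul _ hf hG.lintegral_kernel_prod_right'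
    _ = ∫⁻ a, ∫⁻ b, f a * s.indicator (fun p => g p.2) (a, b) ∂η a ∂ν :=
        lintegral_congr fun a => (lintegral_const_mul _ (hG.comp measurable_prodMk_left)).symm
    _ = ∫⁻ p, f p.1 * s.indicator (fun p => g p.2) p ∂(ν ⊗ₘ η) :=
        (Measure.lintegral_compProd ((hf.comp measurable_fst).mul hG)).symm
    _ = ((ν ⊗ₘ η).withDensity fun p => f p.1 * g p.2) s := by
        rw [withDensity_apply _ hs, ← lintegral_indicator hs]
        simp_rw [Set.indicator_mul_right]

lemma prod_Iic_succ {M : Type*} [CommMonoid M] (n : ℕ) (f : Finset.Iic (n + 1) → M) :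
    ∏ i, f i = (∏ i : Finset.Iic n, f ⟨i, Finset.Iic_subset_Iic.2 n.le_succ i.2⟩) *
      f ⟨n + 1, Finset.mem_Iic.2 le_rfl⟩ := by
  let F : ℕ → M := fun i => if h : i ∈ Finset.Iic (n + 1) then f ⟨i, h⟩ else 1
  have hF (i : ℕ) (h : i ∈ Finset.Iic (n + 1)) : f ⟨i, h⟩ = F i := by simp only [F, dif_pos h]
  simp only [hF]
  rw [Finset.prod_coe_sort _ F, Finset.prod_coe_sort _ F, ← Nat.range_succ_eq_Iic,
    Finset.prod_range_succ, Nat.range_succ_eq_Iic]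

variable {X : ℕ → Type*} [∀ n, MeasurableSpace (X n)] {μ₀ μ₀' : Measure (X 0)}
  {κ κ' : (n : ℕ) → Kernel (Π i : Finset.Iic n, X i) (X (n + 1))} [∀ n, IsMarkovKernel (κ n)]
  [∀ n, IsMarkovKernel (κ' n)] {g : ∀ n, X n → ℝ≥0∞}

lemma map_frestrictLe_zero_trajMeasure :
    (Kernel.trajMeasure μ₀ κ).map (Preorder.frestrictLe 0) =
      μ₀.map (MeasurableEquiv.piUnique fun i : Finset.Iic 0 => X i).symm := by
  rw [Kernel.trajMeasure, Measure.map_comp _ _ (by fun_prop), Kernel.traj_map_frestrictLe,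
    Kernel.partialTraj_self, Measure.id_comp]
  rfl

variable [IsProbabilityMeasure μ₀] [IsProbabilityMeasure μ₀']

lemma map_frestrictLe_succ_trajMeasure (n : ℕ) :
    (Kernel.trajMeasure μ₀ κ).map (Preorder.frestrictLe (n + 1)) =
      ((Kernel.trajMeasure μ₀ κ).map (Preorder.frestrictLe n) ⊗ₘ κ n).map
        fun p => IicProdIoc n (n + 1) (p.1, MeasurableEquiv.piSingleton n p.2) := by
  rw [Kernel.map_frestrictLe_trajMeasure_compProd_eq_map_trajMeasure,
    Measure.map_map (by fun_prop) (by fun_prop)]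
  congr 1
  ext ω ⟨i, hi⟩
  rcases (Finset.mem_Iic.1 hi).lt_or_eq with h | rfl
  · simp [IicProdIoc, Nat.lt_succ_iff.1 h]
  · simp [IicProdIoc, MeasurableEquiv.piSingleton]

lemma map_frestrictLe_trajMeasure_le_withDensity (hg : ∀ n, Measurable (g n))
    (h₀ : μ₀ ≤ μ₀'.withDensity (g 0))
    (h : ∀ n x, κ n x ≤ (κ' n x).withDensity (g (n + 1))) (n : ℕ) :
    (Kernel.trajMeasure μ₀ κ).map (Preorder.frestrictLe n) ≤
      ((Kernel.trajMeasure μ₀' κ').map (Preorder.frestrictLe n)).withDensity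
        fun x => ∏ i : Finset.Iic n, g i (x i) := by
  induction n with
  | zero =>
    rw [map_frestrictLe_zero_trajMeasure, map_frestrictLe_zero_trajMeasure]
    refine map_le_withDensity (by fun_prop) (by fun_prop) (h₀.trans_eq ?_)
    refine congrArg _ (funext fun x => ?_)
    simp only [Fintype.prod_unique]
    rfl
  | succ n ih =>
    rw [map_frestrictLe_succ_trajMeasure, map_frestrictLe_succ_trajMeasure]
    refine map_le_withDensity (by fun_prop) (by fun_prop)
      ((compProd_le_withDensity (by fun_prop) (hg _) ih (h n)).trans_eq ?_)
    congr 1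
    ext p
    rw [Function.comp_apply, prod_Iic_succ]
    congr 1
    · refine Finset.prod_congr rfl fun i _ => ?_
      simp [IicProdIoc, Finset.mem_Iic.1 i.2]
    · simp [IicProdIoc, MeasurableEquiv.piSingleton]

lemma trajMeasure_le_mul (hg : ∀ n, Measurable (g n)) (h₀ : μ₀ ≤ μ₀'.withDensity (g 0))
    (h : ∀ n x, κ n x ≤ (κ' n x).withDensity (g (n + 1))) {n : ℕ} {E : Set (∀ n, X n)}
    (hE : MeasurableSet[Filtration.piLE n] E) {C : ℝ≥0∞}
    (hC : ∀ ω ∈ E, ∏ i ∈ Finset.Iic n, g i (ω i) ≤ C) :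
    Kernel.trajMeasure μ₀ κ E ≤ C * Kernel.trajMeasure μ₀' κ' E := by
  rw [Filtration.piLE_eq_comap_frestrictLe] at hE
  obtain ⟨S, hS, rfl⟩ := hE
  have h_restrict : Measurable (Preorder.frestrictLe (π := X) n) := by fun_prop
  rw [← Measure.map_apply h_restrict hS]
  calc (Kernel.trajMeasure μ₀ κ).map (Preorder.frestrictLe n) S
      ≤ ((Kernel.trajMeasure μ₀' κ').map (Preorder.frestrictLe n)).withDensity
          (fun x => ∏ i : Finset.Iic n, g i (x i)) S :=
        map_frestrictLe_trajMeasure_le_withDensity hg h₀ h n S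
    _ = ∫⁻ ω in Preorder.frestrictLe n ⁻¹' S, ∏ i : Finset.Iic n, g i (ω i)
          ∂Kernel.trajMeasure μ₀' κ' := by
        rw [withDensity_apply _ hS, setLIntegral_map hS (by fun_prop) h_restrict]
        rfl
    _ ≤ ∫⁻ _ in Preorder.frestrictLe n ⁻¹' S, C ∂Kernel.trajMeasure μ₀' κ' := by
        refine setLIntegral_mono' (h_restrict hS) fun ω hω => ?_
        rw [Finset.prod_coe_sort _ fun i => g i (ω i)]
        exact hC ω hω
    _ = C * Kernel.trajMeasure μ₀' κ' (Preorder.frestrictLe n ⁻¹' S) :=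
        setLIntegral_const _ _

end ChangeOfMeasure

section Policy

variable {K : ℕ} {ν ν' : Fin K → ProbabilityMeasure ℝ} {c : Fin K → ℝ≥0∞}

instance (π : Policy K) (ν : Fin K → ProbabilityMeasure ℝ) : IsProbabilityMeasure (π.law ν) := by
  unfold Policy.law
  infer_instance

/-- The likelihood-ratio bound of one round: `c i` if arm `i` was pulled, and `1` if the policy
stopped. It is the factor by which the laws of the round under two bandits can differ when each arm
of the first is at most `c i` times the corresponding arm of the second. -/
def weight (c : Fin K → ℝ≥0∞) : Outcome K → ℝ≥0∞ :=
  Sum.elim (fun p => c p.1) fun _ => 1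

lemma measurable_weight (c : Fin K → ℝ≥0∞) : Measurable (weight c) :=
  ((measurable_of_countable c).comp measurable_fst).sumElim measurable_const

lemma dirac_inr_le_withDensity_weight (c : Fin K → ℝ≥0∞) (k : Fin K) :
    Measure.dirac (.inr k) ≤ (Measure.dirac (.inr k)).withDensity (weight c) := by
  rw [dirac_withDensity' (measurable_weight c)]
  simp [weight]

lemma answer_le_withDensity (h : ∀ i, (ν i : Measure ℝ) ≤ c i • (ν' i : Measure ℝ))
    (d : Decision K) : answer ν d ≤ (answer ν' d).withDensity (weight c) := by
  rcases d with i | k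
  · refine map_le_withDensity (measurable_inl.comp measurable_prodMk_left) (measurable_weight c)
      ((h i).trans_eq ?_)
    exact (withDensity_const (c i)).symm
  · exact dirac_inr_le_withDensity_weight c k

lemma Policy.round_le_withDensity (π : Policy K)
    (h : ∀ i, (ν i : Measure ℝ) ≤ c i • (ν' i : Measure ℝ)) (n : ℕ)
    (x : Finset.Iic n → Outcome K) :
    π.round ν n x ≤ (π.round ν' n x).withDensity (weight c) := by
  simp only [Policy.round, Kernel.piecewise_apply]
  split_ifs with hx
  · obtain ⟨k, hk⟩ := Sum.isRight_iff.1 hx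
    rw [Kernel.deterministic_apply, hk]
    exact dirac_inr_le_withDensity_weight c k
  · rw [Kernel.comp_apply, Kernel.comp_apply]
    exact comp_le_withDensity (measurable_weight c) (answer_le_withDensity h) _

lemma Policy.law_le_mul (π : Policy K) (h : ∀ i, (ν i : Measure ℝ) ≤ c i • (ν' i : Measure ℝ))
    {n : ℕ} {E : Set (ℕ → Outcome K)} (hE : MeasurableSet[Filtration.piLE n] E) {C : ℝ≥0∞}
    (hC : ∀ ω ∈ E, ∏ i ∈ Finset.Iic n, weight c (ω i) ≤ C) :
    π.law ν E ≤ C * π.law ν' E :=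
  trajMeasure_le_mul (g := fun _ => weight c) (fun _ => measurable_weight c)
    (comp_le_withDensity (measurable_weight c) (answer_le_withDensity h) _)
    (fun n x => π.round_le_withDensity h n x) hE hC

end Policy

section Counting

variable {K : ℕ}

lemma measurable_piLE_apply {X : ℕ → Type*} [∀ n, MeasurableSpace (X n)] {i n : ℕ} (hi : i ≤ n) :
    Measurable[Filtration.piLE n] fun ω : ∀ n, X n => ω i :=
  (measurable_pi_apply (X := fun j : Set.Iic n => X j) ⟨i, hi⟩).comp (comap_measurable _)

/-- The event that the policy has not stopped before round `n`. -/
def running (K n : ℕ) : Set (ℕ → Outcome K) :=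
  {ω | ∀ m < n, (ω m).isLeft}

/-- The event that the policy stops after exactly `n` pulls, and declares arm `k`. -/
def stopsAt (k : Fin K) (n : ℕ) : Set (ℕ → Outcome K) :=
  {ω | ω n = .inr k} ∩ running K n

/-- The outcomes in which arm `j` was pulled. -/
def pullOutcomes (j : Fin K) : Set (Outcome K) :=
  Sum.inl '' (Prod.fst ⁻¹' {j})

/-- The event that arm `j` is pulled in round `n`, the policy not having stopped before. -/
def pulls (j : Fin K) (n : ℕ) : Set (ℕ → Outcome K) :=
  {ω | ω n ∈ pullOutcomes j} ∩ running K n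

/-- The number of pulls of arm `j` made before the policy stops. -/
noncomputable def pullCount (j : Fin K) (ω : ℕ → Outcome K) : ℝ≥0∞ :=
  ∑' n, (pulls j n).indicator 1 ω

lemma measurableSet_running (n : ℕ) : MeasurableSet[Filtration.piLE n] (running K n) := by
  have h_isLeft : MeasurableSet {o : Outcome K | o.isLeft} := by
    convert (measurableSet_isRight K).compl using 1
    ext o
    cases o <;> simp
  simp only [running, Set.ofPred_forall]
  exact .iInter fun m => .iInter fun hm =>
    measurable_piLE_apply (X := fun _ => Outcome K) hm.le h_isLeft

lemma measurableSet_stopsAt (k : Fin K) (n : ℕ) :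
    MeasurableSet[Filtration.piLE n] (stopsAt k n) := by
  have h_inr : MeasurableSet ({.inr k} : Set (Outcome K)) := by
    rw [← Set.image_singleton]
    exact measurableSet_inr_image.2 (measurableSet_singleton k)
  exact (measurable_piLE_apply (X := fun _ => Outcome K) le_rfl h_inr).inter
    (measurableSet_running n)

lemma measurableSet_pulls (j : Fin K) (n : ℕ) :
    MeasurableSet[Filtration.piLE n] (pulls j n) :=
  (measurable_piLE_apply (X := fun _ => Outcome K) le_rfl <| measurableSet_inl_image.2 <|
    measurable_fst <| measurableSet_singleton j).inter (measurableSet_running n)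

lemma measurable_pullCount (j : Fin K) : Measurable (pullCount j) :=
  Measurable.tsum fun n =>
    measurable_one.indicator (Filtration.piLE.le n _ (measurableSet_pulls j n))

lemma declares_eq_iUnion (k : Fin K) : declares k = ⋃ n, stopsAt k n := by
  ext ω
  simp [declares, stopsAt, running]

lemma measurableSet_declares (k : Fin K) : MeasurableSet (declares k) := by
  rw [declares_eq_iUnion]
  exact .iUnion fun n => Filtration.piLE.le n _ (measurableSet_stopsAt k n)

lemma eq_of_mem_stopsAt {k l : Fin K} {m n : ℕ} {ω : ℕ → Outcome K} (hm : ω ∈ stopsAt k m)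
    (hn : ω ∈ stopsAt l n) : m = n ∧ k = l := by
  obtain rfl : m = n := by
    rcases lt_trichotomy m n with h | h | h
    · simpa [show ω m = _ from hm.1] using hn.2 m h
    · exact h
    · simpa [show ω n = _ from hn.1] using hm.2 n h
  exact ⟨rfl, Sum.inr_injective (hm.1.symm.trans hn.1)⟩

lemma disjoint_declares {k l : Fin K} (h : k ≠ l) : Disjoint (declares k) (declares l) := by
  rw [Set.disjoint_left]
  rintro ω ⟨m, hm⟩ ⟨n, hn⟩
  exact h (eq_of_mem_stopsAt hm hn).2

lemma measure_declares (μ : Measure (ℕ → Outcome K)) (k : Fin K) :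
    μ (declares k) = ∑' n, μ (stopsAt k n) := by
  rw [declares_eq_iUnion]
  refine measure_iUnion (fun m n hmn => ?_)
    fun n => Filtration.piLE.le n _ (measurableSet_stopsAt k n)
  exact Set.disjoint_left.2 fun ω hm hn => hmn (eq_of_mem_stopsAt hm hn).1

lemma isLeft_of_mem_pullOutcomes {j : Fin K} {o : Outcome K} (h : o ∈ pullOutcomes j) :
    o.isLeft := by
  obtain ⟨p, -, rfl⟩ := h
  rfl

lemma disjoint_pulls {i j : Fin K} (h : i ≠ j) (n : ℕ) : Disjoint (pulls i n) (pulls j n) := by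
  rw [Set.disjoint_left]
  rintro ω ⟨⟨p, rfl, hp⟩, -⟩ ⟨⟨p', rfl, hp'⟩, -⟩
  exact h (congrArg Prod.fst (Sum.inl_injective (hp.trans hp'.symm)))

lemma sum_indicator_pulls_le (s : Finset (Fin K)) (n : ℕ) (ω : ℕ → Outcome K) :
    ∑ j ∈ s, (pulls j n).indicator (1 : (ℕ → Outcome K) → ℝ≥0∞) ω ≤
      (running K (n + 1)).indicator 1 ω := by
  rw [← Finset.indicator_biUnion_apply s (fun j => pulls j n)
    fun i _ j _ hij => disjoint_pulls hij n]
  refine Set.indicator_le_indicator_of_subset (Set.iUnion₂_subset fun j _ ω hω m hm => ?_)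
    (fun _ => zero_le) ω
  rcases (Nat.lt_succ_iff.1 hm).eq_or_lt with rfl | h
  · exact isLeft_of_mem_pullOutcomes hω.1
  · exact hω.2 m h

lemma tsum_indicator_running_le_stoppingTime (ω : ℕ → Outcome K) :
    ∑' n, (running K (n + 1)).indicator (1 : (ℕ → Outcome K) → ℝ≥0∞) ω ≤ stoppingTime ω := by
  refine le_iInf₂ fun n hn => ?_
  have h_notMem (i : ℕ) (hi : n ≤ i) : ω ∉ running K (i + 1) := fun h =>
    Sum.not_isLeft.2 hn (h n (Nat.lt_succ_of_le hi))
  rw [tsum_eq_sum (s := Finset.range n) fun i hi =>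
    Set.indicator_of_notMem (h_notMem i (by simpa using hi)) _]
  calc ∑ i ∈ Finset.range n, (running K (i + 1)).indicator (1 : (ℕ → Outcome K) → ℝ≥0∞) ω
      ≤ ∑ _i ∈ Finset.range n, 1 :=
        Finset.sum_le_sum fun i _ => Set.indicator_le_self' (fun _ _ => zero_le) ω
    _ = n := by simp

lemma sum_pullCount_le_stoppingTime (s : Finset (Fin K)) (ω : ℕ → Outcome K) :
    ∑ j ∈ s, pullCount j ω ≤ stoppingTime ω := by
  simp only [pullCount]
  rw [← Summable.tsum_finsetSum fun _ _ => ENNReal.summable]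
  exact (ENNReal.tsum_le_tsum fun n => sum_indicator_pulls_le s n ω).trans
    (tsum_indicator_running_le_stoppingTime ω)

lemma sum_lintegral_pullCount_le (s : Finset (Fin K)) (μ : Measure (ℕ → Outcome K)) :
    ∑ j ∈ s, ∫⁻ ω, pullCount j ω ∂μ ≤ ∫⁻ ω, stoppingTime ω ∂μ := by
  rw [← lintegral_finsetSum _ fun j _ => measurable_pullCount j]
  exact lintegral_mono fun ω => sum_pullCount_le_stoppingTime s ω

open Classical in
lemma card_pullOutcomes_le_pullCount {n : ℕ} {ω : ℕ → Outcome K} (hω : ω ∈ running K n)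
    (j : Fin K) : (#{i ∈ Finset.Iic n | ω i ∈ pullOutcomes j} : ℝ≥0∞) ≤ pullCount j ω := by
  have h_pulls (i : ℕ) (hi : i ∈ ({i ∈ Finset.Iic n | ω i ∈ pullOutcomes j} : Finset ℕ)) :
      (pulls j i).indicator (1 : (ℕ → Outcome K) → ℝ≥0∞) ω = 1 := by
    rw [Finset.mem_filter, Finset.mem_Iic] at hi
    have h_mem : ω ∈ pulls j i := ⟨hi.2, fun m hm => hω m (hm.trans_le hi.1)⟩
    exact Set.indicator_of_mem h_mem _
  rw [← nsmul_one, ← Finset.sum_const, ← Finset.sum_congr rfl h_pulls]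
  exact ENNReal.sum_le_tsum _

open Classical in
lemma prod_weight_mulSingle (s : Finset ℕ) (j : Fin K) (c : ℝ≥0∞) (ω : ℕ → Outcome K) :
    ∏ i ∈ s, weight (Pi.mulSingle j c) (ω i) = c ^ #{i ∈ s | ω i ∈ pullOutcomes j} := by
  have h_weight (o : Outcome K) :
      weight (Pi.mulSingle j c) o = if o ∈ pullOutcomes j then c else 1 := by
    rcases o with ⟨i, x⟩ | k
    · by_cases h : i = j <;> simp [weight, pullOutcomes, Pi.mulSingle_apply, h]
    · simp [weight, pullOutcomes]
  simp only [h_weight, Finset.prod_ite, Finset.prod_const, one_pow, mul_one]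

lemma prod_weight_mulSingle_le_or_le_pullCount {n : ℕ} {ω : ℕ → Outcome K}
    (hω : ω ∈ running K n) (j : Fin K) {c : ℝ≥0∞} (hc : 1 ≤ c) (m : ℕ) :
    ∏ i ∈ Finset.Iic n, weight (Pi.mulSingle j c) (ω i) ≤ c ^ m ∨
      (m + 1 : ℕ) ≤ pullCount j ω := by
  classical
  rw [prod_weight_mulSingle]
  rcases le_or_gt #{i ∈ Finset.Iic n | ω i ∈ pullOutcomes j} m with h | h
  · exact .inl (pow_le_pow_right₀ hc h)
  · exact .inr (le_trans (Nat.cast_le.2 h) (card_pullOutcomes_le_pullCount hω j))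

end Counting

section TwoBandits

variable {K : ℕ} {ν : Fin K → ProbabilityMeasure ℝ} {ρ : ProbabilityMeasure ℝ} {j k : Fin K}

lemma le_mulSingle_smul_update {c : ℝ≥0∞} (hj : (ν j : Measure ℝ) ≤ c • (ρ : Measure ℝ))
    (i : Fin K) :
    (ν i : Measure ℝ) ≤
      (Pi.mulSingle j c : Fin K → ℝ≥0∞) i • (Function.update ν j ρ i : Measure ℝ) := by
  rcases eq_or_ne i j with rfl | h
  · simpa using hj
  · simp [h]

lemma Policy.law_declares_le (π : Policy K) {c : ℝ≥0∞} (hc : 1 ≤ c)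
    (hj : (ν j : Measure ℝ) ≤ c • (ρ : Measure ℝ)) (k : Fin K) (m : ℕ) :
    π.law ν (declares k) ≤ π.law ν {ω | (m + 1 : ℕ) ≤ pullCount j ω} +
      c ^ m * π.law (Function.update ν j ρ) (declares k) := by
  let E (n : ℕ) : Set (ℕ → Outcome K) :=
    stopsAt k n ∩ {ω | ∏ i ∈ Finset.Iic n, weight (Pi.mulSingle j c) (ω i) ≤ c ^ m}
  have hE (n : ℕ) : MeasurableSet[Filtration.piLE n] (E n) := by
    refine (measurableSet_stopsAt k n).inter (measurableSet_le ?_ measurable_const)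
    exact Finset.measurable_prod _ fun i hi =>
      (measurable_weight _).comp (measurable_piLE_apply (Finset.mem_Iic.1 hi))
  have h_subset : declares k ⊆ {ω | (m + 1 : ℕ) ≤ pullCount j ω} ∪ ⋃ n, E n := by
    rw [declares_eq_iUnion]
    refine Set.iUnion_subset fun n ω hω => ?_
    exact (prod_weight_mulSingle_le_or_le_pullCount hω.2 j hc m).symm.imp id
      fun h => Set.mem_iUnion.2 ⟨n, hω, h⟩
  have h_law (n : ℕ) :
      π.law ν (E n) ≤ c ^ m * π.law (Function.update ν j ρ) (stopsAt k n) :=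
    (π.law_le_mul (le_mulSingle_smul_update hj) (hE n) fun ω hω => hω.2).trans
      (mul_le_mul_right (measure_mono Set.inter_subset_left) _)
  calc π.law ν (declares k)
      ≤ π.law ν {ω | (m + 1 : ℕ) ≤ pullCount j ω} + π.law ν (⋃ n, E n) :=
        (measure_mono h_subset).trans (measure_union_le _ _)
    _ ≤ π.law ν {ω | (m + 1 : ℕ) ≤ pullCount j ω} +
          ∑' n, c ^ m * π.law (Function.update ν j ρ) (stopsAt k n) := by
        gcongr
        exact (measure_iUnion_le _).trans (ENNReal.tsum_le_tsum h_law)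
    _ = _ := by rw [ENNReal.tsum_mul_left, measure_declares]

lemma Policy.law_declares_le_of_le_law_declares (π : Policy K) {δ : ℝ} (hjk : j ≠ k)
    (h : ENNReal.ofReal (1 - δ) ≤ π.law ν (declares j)) :
    π.law ν (declares k) ≤ ENNReal.ofReal δ := by
  calc π.law ν (declares k)
      ≤ π.law ν (declares j)ᶜ := measure_mono (disjoint_declares hjk).subset_compl_left
    _ = 1 - π.law ν (declares j) := prob_compl_eq_one_sub (measurableSet_declares j)
    _ ≤ 1 - ENNReal.ofReal (1 - δ) := tsub_le_tsub_left h 1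
    _ ≤ ENNReal.ofReal δ := by
        rw [tsub_le_iff_right, ← ENNReal.ofReal_one]
        simpa using ENNReal.ofReal_add_le (p := δ) (q := 1 - δ)

lemma Policy.mul_le_lintegral_pullCount (π : Policy K) (hjk : j ≠ k) {c δ : ℝ} (hc : 1 ≤ c)
    (hδ : 0 ≤ δ) (hj : (ν j : Measure ℝ) ≤ ENNReal.ofReal c • (ρ : Measure ℝ))
    (h_declares : ENNReal.ofReal (1 - δ) ≤ π.law ν (declares k))
    (h_declares' : ENNReal.ofReal (1 - δ) ≤ π.law (Function.update ν j ρ) (declares j)) (m : ℕ) :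
    ENNReal.ofReal ((m + 1) * (1 - δ - c ^ m * δ)) ≤ ∫⁻ ω, pullCount j ω ∂π.law ν := by
  have h_tail : ENNReal.ofReal (1 - δ - c ^ m * δ) ≤
      π.law ν {ω | (m + 1 : ℕ) ≤ pullCount j ω} := by
    rw [ENNReal.ofReal_sub _ (by positivity), tsub_le_iff_right,
      ENNReal.ofReal_mul (by positivity), ENNReal.ofReal_pow (by positivity)]
    refine h_declares.trans ((π.law_declares_le (ENNReal.one_le_ofReal.2 hc) hj k m).trans ?_)
    gcongr
    exact π.law_declares_le_of_le_law_declares hjk h_declares'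
  calc ENNReal.ofReal ((m + 1) * (1 - δ - c ^ m * δ))
      = (m + 1 : ℕ) * ENNReal.ofReal (1 - δ - c ^ m * δ) := by
        rw [ENNReal.ofReal_mul (by positivity), ← Nat.cast_succ, ENNReal.ofReal_natCast]
    _ ≤ (m + 1 : ℕ) * π.law ν {ω | (m + 1 : ℕ) ≤ pullCount j ω} := by gcongr
    _ ≤ ∫⁻ ω, pullCount j ω ∂π.law ν := mul_meas_ge_le_lintegral (measurable_pullCount j) _

lemma Policy.log_div_log_le_lintegral_pullCount (π : Policy K) (hjk : j ≠ k) {c δ : ℝ}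
    (hc : 1 < c) (hδ : 0 < δ) (hj : (ν j : Measure ℝ) ≤ ENNReal.ofReal c • (ρ : Measure ℝ))
    (h_declares : ENNReal.ofReal (1 - δ) ≤ π.law ν (declares k))
    (h_declares' : ENNReal.ofReal (1 - δ) ≤ π.law (Function.update ν j ρ) (declares j)) :
    ENNReal.ofReal (Real.log (1 / (4 * δ)) / (2 * Real.log c)) ≤
      ∫⁻ ω, pullCount j ω ∂π.law ν := by
  have h_log : 0 < Real.log c := Real.log_pos hc
  rcases le_total 1 (4 * δ) with h | h
  · rw [ENNReal.ofReal_of_nonpos]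
    · exact zero_le
    exact div_nonpos_of_nonpos_of_nonneg
      (Real.log_nonpos (by positivity) ((div_le_one (by positivity)).2 h)) (by positivity)
  obtain ⟨m, hm, hm'⟩ := exists_nat_pow_near ((one_le_div (by positivity)).2 h) hc
  have h_pow : c ^ m * (4 * δ) ≤ 1 := (le_div_iff₀ (by positivity)).1 hm
  have h_count : Real.log (1 / (4 * δ)) ≤ (m + 1) * Real.log c := by
    rw [← Nat.cast_succ, ← Real.log_pow]
    exact Real.log_le_log (by positivity) hm'.le
  refine le_trans (ENNReal.ofReal_le_ofReal ?_)
    (π.mul_le_lintegral_pullCount hjk hc.le hδ.le hj h_declares h_declares' m)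
  calc Real.log (1 / (4 * δ)) / (2 * Real.log c)
      ≤ (m + 1) * Real.log c / (2 * Real.log c) := by gcongr
    _ = (m + 1) * (1 / 2) := by field_simp
    _ ≤ (m + 1) * (1 - δ - c ^ m * δ) := by
        gcongr
        linarith

end TwoBandits

section HardInstance

variable {K : ℕ} {q δ : ℝ} {i j k : Fin K} {π : Policy K} {w : Fin K → Set.Ioo (0 : ℝ) 1}

/-- The mixture `w δ₀ + (1 - w) Unif[0,1]` as an arm of a bandit. -/
noncomputable def mixtureArm (w : Set.Ioo (0 : ℝ) 1) : ProbabilityMeasure ℝ :=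
  ⟨zeroUniformMixture w, isProbabilityMeasure_zeroUniformMixture w.2.1.le w.2.2.le⟩

lemma isBestArm_mixtureArm (hq1 : q < 1) (hk : w k < q) (hw : ∀ i ≠ k, w k < w i) :
    IsBestArm q (mixtureArm ∘ w) k := fun i hi =>
  quantile_zeroUniformMixture_lt hq1 (w k).2.1.le (hw i hi) hk (w i).2.2

lemma Policy.IsPAC.le_law_declares (hπ : π.IsPAC q δ) (hq1 : q < 1) (hk : w k < q)
    (hw : ∀ i ≠ k, w k < w i) :
    ENNReal.ofReal (1 - δ) ≤ π.law (mixtureArm ∘ w) (declares k) :=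
  hπ _ k (isBestArm_mixtureArm hq1 hk hw) fun i hi =>
    gap_zeroUniformMixture_pos ((w k).2.1.trans hk) hq1 (w k).2.1.le (hw i hi) (w i).2.2

lemma Policy.IsPAC.log_div_log_le_lintegral_pullCount (hπ : π.IsPAC q δ) (hq1 : q < 1)
    (hδ : 0 < δ) (hk : w k < q) (hw : ∀ i ≠ k, w k < w i) {v : Set.Ioo (0 : ℝ) 1}
    (hv : v < w k) (hjk : j ≠ k) :
    ENNReal.ofReal (Real.log (1 / (4 * δ)) / (2 * Real.log (w j / v))) ≤
      ∫⁻ ω, pullCount j ω ∂π.law (mixtureArm ∘ w) := by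
  have hvj : v < w j := hv.trans (hw j hjk)
  have h_best : ∀ i ≠ j, Function.update w j v j < Function.update w j v i := fun i hi => by
    rw [Function.update_self, Function.update_of_ne hi]
    rcases eq_or_ne i k with rfl | hik
    · exact hv
    · exact hv.trans (hw i hik)
  have h_level : (Function.update w j v j : ℝ) < q := by
    rw [Function.update_self]
    exact lt_trans hv hk
  have h_declares := hπ.le_law_declares hq1 h_level h_best
  rw [Function.comp_update] at h_declares
  exact π.log_div_log_le_lintegral_pullCount (ρ := mixtureArm v) hjk
    ((one_lt_div v.2.1).2 hvj) hδ (zeroUniformMixture_le_smul v.2.1 hvj.le)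
    (hπ.le_law_declares hq1 hk hw) h_declares

/-- The weights of the hard instance: the best arm `k` has weight `1/6`, the others `7/12`. Then
`(7/12 - 1/6) / (2 - 7/12 - 1/6) = 1/3`, which bounds the gaps below by `(1 - q) / 3`. -/
noncomputable def hardWeight (k : Fin K) (i : Fin K) : Set.Ioo (0 : ℝ) 1 :=
  if i = k then ⟨1 / 6, by norm_num, by norm_num⟩ else ⟨7 / 12, by norm_num, by norm_num⟩

lemma coe_hardWeight_self (k : Fin K) : (hardWeight k k : ℝ) = 1 / 6 := by
  simp [hardWeight]

lemma coe_hardWeight_of_ne (h : i ≠ k) : (hardWeight k i : ℝ) = 7 / 12 := by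
  simp [hardWeight, h]

lemma coe_hardWeight_self_lt (hq : 1 / 3 < q) (k : Fin K) : hardWeight k k < q := by
  rw [coe_hardWeight_self]
  linarith

lemma hardWeight_self_lt (k : Fin K) : ∀ i ≠ k, hardWeight k k < hardWeight k i := fun i hi => by
  rw [← Subtype.coe_lt_coe, coe_hardWeight_self, coe_hardWeight_of_ne hi]
  norm_num

lemma gap_hardWeight (hq : 1 / 3 < q) (hq1 : q < 1) (hi : i ≠ k) :
    gap q (mixtureArm (hardWeight k i)) (mixtureArm (hardWeight k k)) =
      max (7 / 12 - q) ((1 - q) / 3) := by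
  have h_gap := gap_zeroUniformMixture (by linarith) hq1 (hardWeight k k).2.1.le
    (hardWeight_self_lt k i hi).le (hardWeight k i).2.2
  rw [coe_hardWeight_self, coe_hardWeight_of_ne hi,
    show (1 - q) * (7 / 12 - 1 / 6) / (2 - 7 / 12 - 1 / 6) = (1 - q) / 3 by ring,
    min_eq_right (max_le (by linarith) (by linarith))] at h_gap
  rw [← h_gap, ← coe_hardWeight_self k, ← coe_hardWeight_of_ne hi]
  rfl

lemma gap_hardWeight_mem_Ioo (hq : 1 / 3 < q) (hq1 : q < 1) (hi : i ≠ k) :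
    gap q (mixtureArm (hardWeight k i)) (mixtureArm (hardWeight k k)) ∈ Set.Ioo 0 (1 / 4) := by
  rw [gap_hardWeight hq hq1 hi]
  exact ⟨lt_max_of_lt_right (by linarith), max_lt (by linarith) (by linarith)⟩

lemma three_mul_sq_div_le_one_div_two_mul_log_four {x g : ℝ} (hx : 0 < x) (hg : x / 3 ≤ g) :
    3 * x ^ 2 / (100 * g ^ 2) ≤ 1 / (2 * Real.log 4) := by
  have h_log : Real.log 4 ≤ 7 / 5 := by
    rw [show (4 : ℝ) = 2 ^ 2 by norm_num, Real.log_pow]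
    linarith [Real.log_two_lt_d9]
  have : 0 < Real.log 4 := Real.log_pos (by norm_num)
  have h_sq : x ^ 2 ≤ 9 * g ^ 2 := by nlinarith
  have hg0 : 0 < g := by linarith
  calc 3 * x ^ 2 / (100 * g ^ 2)
      ≤ 3 * (9 * g ^ 2) / (100 * g ^ 2) := by gcongr
    _ = 27 / 100 := by field_simp; norm_num
    _ ≤ 1 / (2 * (7 / 5)) := by norm_num
    _ ≤ 1 / (2 * Real.log 4) := by gcongr

lemma Policy.IsPAC.le_lintegral_pullCount_hardWeight (hπ : π.IsPAC q δ) (hq : 1 / 3 < q)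
    (hq1 : q < 1) (hδ : 0 < δ) (hjk : j ≠ k) :
    ENNReal.ofReal (3 * (1 - q) ^ 2 /
        (100 * gap q (mixtureArm (hardWeight k j)) (mixtureArm (hardWeight k k)) ^ 2) *
          Real.log (1 / (4 * δ))) ≤
      ∫⁻ ω, pullCount j ω ∂π.law (mixtureArm ∘ hardWeight k) := by
  -- With `v = 7/48`, the likelihood ratio `(7/12) / v` of the two bandits is `4`.
  have h_count := hπ.log_div_log_le_lintegral_pullCount hq1 hδ (coe_hardWeight_self_lt hq k)
    (hardWeight_self_lt k) (v := ⟨7 / 48, by norm_num, by norm_num⟩)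
    (by rw [← Subtype.coe_lt_coe, coe_hardWeight_self]; norm_num) hjk
  rw [coe_hardWeight_of_ne hjk, show (7 / 12 / (7 / 48) : ℝ) = 4 by norm_num] at h_count
  refine le_trans ?_ h_count
  have : 0 ≤ Real.log 4 := Real.log_nonneg (by norm_num)
  rw [← one_div_mul_eq_div (2 * Real.log 4), ENNReal.ofReal_mul (by positivity),
    ENNReal.ofReal_mul (by positivity)]
  refine mul_le_mul_left (ENNReal.ofReal_le_ofReal ?_) _
  refine three_mul_sq_div_le_one_div_two_mul_log_four (sub_pos.2 hq1) ?_
  rw [gap_hardWeight hq hq1 hjk]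
  exact le_max_right _ _

lemma Policy.IsPAC.le_lintegral_stoppingTime_hardWeight (hπ : π.IsPAC q δ) (hq : 1 / 3 < q)
    (hq1 : q < 1) (hδ : 0 < δ) (k : Fin K) :
    ENNReal.ofReal (∑ j ∈ Finset.univ.erase k, 3 * (1 - q) ^ 2 /
        (100 * gap q (mixtureArm (hardWeight k j)) (mixtureArm (hardWeight k k)) ^ 2) *
          Real.log (1 / (4 * δ))) ≤
      ∫⁻ ω, stoppingTime ω ∂π.law (mixtureArm ∘ hardWeight k) := by
  calc _ ≤ ∑ j ∈ Finset.univ.erase k, ENNReal.ofReal (3 * (1 - q) ^ 2 /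
          (100 * gap q (mixtureArm (hardWeight k j)) (mixtureArm (hardWeight k k)) ^ 2) *
            Real.log (1 / (4 * δ))) :=
        Finset.le_sum_of_subadditive ENNReal.ofReal ENNReal.ofReal_zero.le
          (fun _ _ => ENNReal.ofReal_add_le) _ _
    _ ≤ ∑ j ∈ Finset.univ.erase k, ∫⁻ ω, pullCount j ω ∂π.law (mixtureArm ∘ hardWeight k) :=
        Finset.sum_le_sum fun j hj =>
          hπ.le_lintegral_pullCount_hardWeight hq hq1 hδ (Finset.ne_of_mem_erase hj)
    _ ≤ _ := sum_lintegral_pullCount_le _ _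

end HardInstance

end QuantileBandit

theorem theorem4 (K : ℕ) (hK : 1 ≤ K) (q : ℝ) (hq : 1 / 3 < q) (hq1 : q < 1)
    (δ : ℝ) (hδ : 0 < δ) (hδ1 : δ < 1) :
    ∃ (ν : Fin K → ProbabilityMeasure ℝ) (istar : Fin K),
      (∃ w : Fin K → ℝ, ∀ i, w i ∈ Set.Ioo (0 : ℝ) 1 ∧
        (ν i : Measure ℝ) = QuantileBandit.zeroUniformMixture (w i)) ∧
      QuantileBandit.IsBestArm q ν istar ∧
      (∀ i, i ≠ istar → QuantileBandit.gap q (ν i) (ν istar) ∈ Set.Ioo (0 : ℝ) (1 / 4)) ∧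
      ∀ π : QuantileBandit.Policy K, π.IsPAC q δ →
        ENNReal.ofReal (∑ j ∈ Finset.univ.erase istar,
          3 * (1 - q) ^ 2 / (100 * QuantileBandit.gap q (ν j) (ν istar) ^ 2) *
            Real.log (1 / (4 * δ)))
        ≤ ∫⁻ ω, QuantileBandit.stoppingTime ω ∂(π.law ν) := by
  let k : Fin K := ⟨0, hK⟩
  open QuantileBandit in
  exact ⟨mixtureArm ∘ hardWeight k, k, ⟨fun i => hardWeight k i, fun i =>
      ⟨(hardWeight k i).2, rfl⟩⟩,
    isBestArm_mixtureArm hq1 (coe_hardWeight_self_lt hq k) (hardWeight_self_lt k),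
    fun i hi => gap_hardWeight_mem_Ioo hq hq1 hi,
    fun π hπ => hπ.le_lintegral_stoppingTime_hardWeight hq hq1 hδ k⟩
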